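/- Let $(M,d)$ be a complete metric space with a base point $0$ and with at least three points. Put $\widetilde M=\{(x,y)\in M\times M: x\neq y\}$, let $\beta\widetilde M$ be its Stone–Čech compactification, and let $\mathcal M(\beta\widetilde M)^+$ be the set of positive finite Radon measures on $\beta\widetilde M$. Let $G$ be the set of all continuous functions $g:\beta\widetilde M\to\mathbb R$ such that $$d(x,y)\,g(x,y)\le d(x,u)\,g(x,u)+d(u,y)\,g(u,y)\quad\text{whenever } x,u,y\in M \text{ are distinct}.$$ For $\mu,\nu\in\mathcal M(\beta\widetilde M)^+$ write $\mu\preccurlyeq\nu$ if $\int g\,d\mu\le\int g\,d\nu$ for all $g\in G$, and call $\mu$ minimal if $\mu\preccurlyeq\nu$ for every $\nu\in\mathcal M(\beta\widetilde M)^+$ with $\nu\preccurlyeq\mu$. Let $M^{\mathcal U}$ be the uniform (Samuel) compactification of $M$, and let $M^{\mathcal R}=\{\xi\in M^{\mathcal U}: d^{\mathcal U}(\xi,0)<\infty\}$ be the Lipschitz realcompactification of $M$, where $d^{\mathcal U}(\cdot,0):M^{\mathcal U}\to[0,\infty]$ is the continuous extension of $d(\cdot,0)$. Let $\mathfrak p_1,\mathfrak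 p_2:\beta\widetilde M\to M^{\mathcal U}$ be the continuous extensions of $(x,y)\mapsto x$ and $(x,y)\mapsto y$. **Theorem.** Let $\mu\in\mathcal M(\beta\widetilde M)^+$ be minimal and concentrated on the set $$\{\zeta\in\beta\widetilde M:\ \mathfrak p_1(\zeta)\in M^{\mathcal R},\ \mathfrak p_2(\zeta)\in M^{\mathcal R},\ \mathfrak p_1(\zeta)\neq\mathfrak p_2(\zeta)\}.$$ Then the marginals (push-forward measures) $(\mathfrak p_1)_\sharp\mu$ and $(\mathfrak p_2)_\sharp\mu$ on $M^{\mathcal U}$ are mutually singular. -/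

import Mathlib

open Set Filter Topology MeasureTheory
open scoped ENNReal

noncomputable section

namespace LipFree

universe u

/-- The space `M̃` of pairs of distinct points of `M`. -/
abbrev OffDiag (M : Type u) : Type u := {p : M × M // p.1 ≠ p.2}

/-! ### The uniform (Samuel) compactification -/

/-- The uniformly continuous functions from `M` to `[0, 1]`. -/
abbrev UnitUC (M : Type u) [MetricSpace M] : Type u :=
  {f : M → Icc (0 : ℝ) 1 // UniformContinuous f}

/-- The evaluation map from `M` to the cube indexed by all uniformly continuous `f : M → [0, 1]`. -/
def cubeMap (M : Type u) [MetricSpace M] (x : M) : UnitUC M → Icc (0 : ℝ) 1 :=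
  fun f => f.1 x

/-- The uniform (Samuel) compactification of `M`: the closure of the image of `M` in the cube
indexed by all uniformly continuous functions `M → [0, 1]`. -/
def UComp (M : Type u) [MetricSpace M] : Type u :=
  ↥(closure (range (cubeMap M)))

instance (M : Type u) [MetricSpace M] : TopologicalSpace (UComp M) :=
  inferInstanceAs (TopologicalSpace ↥(closure (range (cubeMap M))))

instance (M : Type u) [MetricSpace M] : T2Space (UComp M) :=
  inferInstanceAs (T2Space ↥(closure (range (cubeMap M))))

instance (M : Type u) [MetricSpace M] : CompactSpace (UComp M) :=
  isCompact_iff_compactSpace.mp isClosed_closure.isCompact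

instance (M : Type u) [MetricSpace M] : MeasurableSpace (UComp M) := borel _

instance (M : Type u) [MetricSpace M] : BorelSpace (UComp M) := ⟨rfl⟩

/-- The canonical map of `M` into its uniform compactification. -/
def toUComp {M : Type u} [MetricSpace M] (x : M) : UComp M :=
  ⟨cubeMap M x, subset_closure (mem_range_self x)⟩

theorem continuous_toUComp {M : Type u} [MetricSpace M] :
    Continuous (toUComp : M → UComp M) :=
  Continuous.subtype_mk (continuous_pi fun f => f.2.continuous) _

/-- The coordinates of a point of the uniform compactification in the cube. -/
def UComp.val {M : Type u} [MetricSpace M] (ξ : UComp M) : UnitUC M → Icc (0 : ℝ) 1 :=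
  Subtype.val ξ

theorem UComp.isInducing_val {M : Type u} [MetricSpace M] :
    IsInducing (UComp.val : UComp M → UnitUC M → Icc (0 : ℝ) 1) :=
  IsInducing.subtypeVal

theorem UComp.continuous_apply {M : Type u} [MetricSpace M] (f : UnitUC M) :
    Continuous fun ξ : UComp M => ξ.val f :=
  (_root_.continuous_apply f).comp UComp.isInducing_val.continuous

theorem isDenseInducing_toUComp {M : Type u} [MetricSpace M] :
    IsDenseInducing (toUComp : M → UComp M) := by
  refine IsDenseInducing.mk' _ continuous_toUComp ?_ ?_
  · intro y
    rw [UComp.isInducing_val.closure_eq_preimage_closure_image, mem_preimage, ← range_comp]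
    exact y.2
  · intro a s hs
    obtain ⟨ε, hε, hs⟩ := Metric.mem_nhds_iff.mp hs
    let f : M → Icc (0 : ℝ) 1 := fun x => projIcc 0 1 zero_le_one (dist x a)
    have hf : UniformContinuous f :=
      (LipschitzWith.projIcc zero_le_one).uniformContinuous.comp
        (uniformContinuous_id.dist uniformContinuous_const)
    refine ⟨{ξ : UComp M | ((ξ.val ⟨f, hf⟩ : Icc (0 : ℝ) 1) : ℝ) < min ε 1}, ?_, ?_⟩
    · refine IsOpen.mem_nhds (isOpen_lt ?_ continuous_const) ?_
      · exact continuous_subtype_val.comp (UComp.continuous_apply _)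
      · change ((f a : Icc (0 : ℝ) 1) : ℝ) < min ε 1
        simp [f, hε]
    · intro b hb
      apply hs
      have hb' : ((f b : Icc (0 : ℝ) 1) : ℝ) < min ε 1 := hb
      simp only [f, coe_projIcc] at hb'
      rw [Metric.mem_ball]
      rcases le_total (dist b a) 1 with h | h
      · rw [min_eq_right h, max_eq_right dist_nonneg] at hb'
        exact lt_of_lt_of_le hb' (min_le_left _ _)
      · rw [min_eq_left h] at hb'
        have := lt_of_lt_of_le hb' (min_le_right _ _)
        simp at this

/-! ### The Lipschitz realcompactification -/

/-- The continuous extension to the uniform compactification, with values in `[0, ∞]`, of the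
distance to the base point `o`. -/
def ucompDist {M : Type u} [MetricSpace M] (o : M) : UComp M → ℝ≥0∞ :=
  isDenseInducing_toUComp.extend fun x => edist x o

theorem ucompDist_spec {M : Type u} [MetricSpace M] (o : M) :
    Continuous (ucompDist o) ∧ ∀ x : M, ucompDist o (toUComp x) = edist x o := by
  let φ := ENNReal.orderIsoUnitIntervalBirational
  have hval : ∀ x : M, ((φ (edist x o) : Icc (0 : ℝ) 1) : ℝ) = 1 - (1 + dist x o)⁻¹ := by
    intro x
    have h1 : (0 : ℝ) ≤ dist x o := dist_nonneg
    rw [ENNReal.orderIsoUnitIntervalBirational_apply_coe, edist_dist]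
    rcases h1.eq_or_lt with h | h
    · simp [← h]
    · rw [← ENNReal.ofReal_inv_of_pos h, ← ENNReal.ofReal_one,
        ← ENNReal.ofReal_add (by positivity) zero_le_one,
        ← ENNReal.ofReal_inv_of_pos (by positivity), ENNReal.toReal_ofReal (by positivity)]
      field_simp
      ring
  have hf : UniformContinuous fun x : M => φ (edist x o) := by
    refine LipschitzWith.uniformContinuous (K := 1) (LipschitzWith.of_dist_le_mul fun x y => ?_)
    rw [Subtype.dist_eq, hval, hval, Real.dist_eq, NNReal.coe_one, one_mul]
    have hx : (0 : ℝ) ≤ dist x o := dist_nonneg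
    have hy : (0 : ℝ) ≤ dist y o := dist_nonneg
    have e : 1 - (1 + dist x o)⁻¹ - (1 - (1 + dist y o)⁻¹)
        = (dist x o - dist y o) / ((1 + dist x o) * (1 + dist y o)) := by
      field_simp
      ring
    rw [e, abs_div, abs_of_pos (show 0 < (1 + dist x o) * (1 + dist y o) by positivity)]
    refine le_trans (div_le_self (abs_nonneg _) ?_) (abs_dist_sub_le x y o)
    nlinarith [mul_nonneg hx hy]
  have hg : Continuous fun ξ : UComp M => φ.symm (ξ.val ⟨_, hf⟩) :=
    φ.symm.continuous.comp (UComp.continuous_apply _)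
  have he : ucompDist o = fun ξ : UComp M => φ.symm (ξ.val ⟨_, hf⟩) :=
    isDenseInducing_toUComp.extend_unique (fun x => φ.symm_apply_apply _) hg
  rw [he]
  exact ⟨hg, fun x => φ.symm_apply_apply _⟩

/-- The Lipschitz realcompactification of `M`, as a subset of the uniform compactification. -/
def rcomp {M : Type u} [MetricSpace M] (o : M) : Set (UComp M) :=
  {ξ | ucompDist o ξ < ∞}

/-! ### The Stone–Čech compactification of `M̃` and its coordinate maps -/

/-- The Stone–Čech compactification of `M̃`. -/
abbrev BetaOffDiag (M : Type u) [MetricSpace M] : Type u := StoneCech (OffDiag M)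

instance (M : Type u) [MetricSpace M] : MeasurableSpace (BetaOffDiag M) := borel _

instance (M : Type u) [MetricSpace M] : BorelSpace (BetaOffDiag M) := ⟨rfl⟩

theorem continuous_toUComp_fst (M : Type u) [MetricSpace M] :
    Continuous fun p : OffDiag M => toUComp p.1.1 :=
  continuous_toUComp.comp (continuous_fst.comp continuous_subtype_val)

theorem continuous_toUComp_snd (M : Type u) [MetricSpace M] :
    Continuous fun p : OffDiag M => toUComp p.1.2 :=
  continuous_toUComp.comp (continuous_snd.comp continuous_subtype_val)

/-- The first coordinate map: the continuous extension of `(x, y) ↦ x`. -/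
def coord₁ {M : Type u} [MetricSpace M] : BetaOffDiag M → UComp M :=
  stoneCechExtend (continuous_toUComp_fst M)

/-- The second coordinate map: the continuous extension of `(x, y) ↦ y`. -/
def coord₂ {M : Type u} [MetricSpace M] : BetaOffDiag M → UComp M :=
  stoneCechExtend (continuous_toUComp_snd M)

/-- The set of points of `β M̃` whose coordinates are distinct and both belong to the Lipschitz
realcompactification of `M` (with base point `o`). -/
def distinctRealCoords {M : Type u} [MetricSpace M] (o : M) : Set (BetaOffDiag M) :=
  {ζ | coord₁ ζ ∈ rcomp o ∧ coord₂ ζ ∈ rcomp o ∧ coord₁ ζ ≠ coord₂ ζ}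

/-! ### The cone `G`, the quasi-order and minimality -/

/-- The cone `G` of all continuous `g : β M̃ → ℝ` such that
`d(x,y) g(x,y) ≤ d(x,u) g(x,u) + d(u,y) g(u,y)` for all distinct `x, u, y` in `M`. -/
def coneG (M : Type u) [MetricSpace M] : Set C(BetaOffDiag M, ℝ) :=
  {g | ∀ (x v y : M) (hxv : x ≠ v) (hvy : v ≠ y) (hxy : x ≠ y),
    dist x y * g (stoneCechUnit ⟨(x, y), hxy⟩) ≤
      dist x v * g (stoneCechUnit ⟨(x, v), hxv⟩) + dist v y * g (stoneCechUnit ⟨(v, y), hvy⟩)}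

/-- Positive finite Radon measures on `β M̃`. -/
def IsPosRadon {M : Type u} [MetricSpace M] (μ : Measure (BetaOffDiag M)) : Prop :=
  IsFiniteMeasure μ ∧ μ.Regular

/-- The quasi-order on positive Radon measures determined by `G`. -/
def GLE {M : Type u} [MetricSpace M] (μ ν : Measure (BetaOffDiag M)) : Prop :=
  ∀ g ∈ coneG M, ∫ ζ, g ζ ∂μ ≤ ∫ ζ, g ζ ∂ν

/-- `μ` is a positive Radon measure on `β M̃` that is minimal for the quasi-order. -/
def IsMinimal {M : Type u} [MetricSpace M] (μ : Measure (BetaOffDiag M)) : Prop :=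
  IsPosRadon μ ∧ ∀ ν : Measure (BetaOffDiag M), IsPosRadon ν → GLE ν μ → GLE μ ν

end LipFree

end

/-!
The function `1 / (1 + d)` lies in the cone `G`, and the inequality defining the cone is strict for
it, because `t ↦ t / (1 + t)` is strictly subadditive (`div_one_add_add_lt`). The proof tests
minimality against this single function.

If `μ` is minimal, no positive measure `ν ≼ μ` has a smaller integral of `1 / (1 + d)` than `μ`. By
Hahn–Banach and Riesz representation (`exists_measure_le_on_cone`) this means that there are
`g ∈ G` with `g ≥ -1 / (1 + d)` and `∫ (g + 1 / (1 + d)) ∂μ` arbitrarily small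
(`IsMinimal.exists_integral_lt`). Hence a sequence of such `g` converges to `-1 / (1 + d)` on a set
of full measure.

Let `ζ` and `ω` be in this set, with extended distances `a, b ∈ (0, ∞)`, and let the second
coordinate of `ζ` be the first coordinate of `ω`. Two points of `M̃` close to `ζ` and `ω` can be
chosen with second and first coordinate arbitrarily close in `M`, by the definition of the uniform
compactification (`neBot_nhds_of_coord_eq`), so the inequality defining `G` passes to the limit
(`le_of_coord_eq`). For the convergent sequence it yields
`a / (1 + a) + b / (1 + b) ≤ (a + b) / (1 + (a + b))`, a contradiction. So on a set of full measure
no second coordinate is a first coordinate, and inner regularity gives disjoint Borel sets that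
carry the two marginals (`mutuallySingular_map_of_forall_ne`). No product measure or disintegration
on the nonmetrizable space `β M̃` is needed.
-/

namespace LipFree

universe u

variable {M : Type u} [MetricSpace M]

/-! ### Representing positive functionals dominated on a convex cone -/

/-- A positive linear functional on `C(X, ℝ)`, for `X` compact Hausdorff, is integration against a
finite regular measure. -/
theorem exists_regular_measure_of_nonneg {X : Type*} [TopologicalSpace X] [T2Space X]
    [CompactSpace X] [MeasurableSpace X] [BorelSpace X] (L : C(X, ℝ) →ₗ[ℝ] ℝ)
    (hL : ∀ f, 0 ≤ f → 0 ≤ L f) :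
    ∃ ν : Measure X, IsFiniteMeasure ν ∧ ν.Regular ∧ ∀ f : C(X, ℝ), ∫ x, f x ∂ν = L f := by
  let Λ : CompactlySupportedContinuousMap X ℝ →ₚ[ℝ] ℝ := PositiveLinearMap.mk₀
    { toFun := fun f => L f.toContinuousMap
      map_add' := fun f g => L.map_add f.toContinuousMap g.toContinuousMap
      map_smul' := fun c f => L.map_smul c f.toContinuousMap }
    (fun f hf => hL _ fun x => hf x)
  refine ⟨RealRMK.rieszMeasure Λ, inferInstance, inferInstance, fun f => ?_⟩
  exact RealRMK.integral_rieszMeasure Λ (CompactlySupportedContinuousMap.continuousMapEquiv f)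

/-- The Hahn–Banach duality behind minimality. Let `C` be a convex cone of continuous functions
that contains the nonnegative constants, and let `e` be continuous. If `∫ g ∂μ ≥ -k` for all
`g ∈ C` with `g ≥ -e`, then some positive measure `ν` lies below `μ` on `C` and has
`∫ e ∂ν ≤ k`. -/
theorem exists_measure_le_on_cone {X : Type*} [TopologicalSpace X] [T2Space X]
    [CompactSpace X] [MeasurableSpace X] [BorelSpace X] (μ : Measure X) [IsFiniteMeasure μ]
    (C : Set C(X, ℝ)) (hadd : ∀ f ∈ C, ∀ g ∈ C, f + g ∈ C)
    (hsmul : ∀ c : ℝ, 0 ≤ c → ∀ g ∈ C, c • g ∈ C)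
    (hconst : ∀ c : ℝ, 0 ≤ c → ContinuousMap.const X c ∈ C) (e : C(X, ℝ)) (k : ℝ)
    (hk : ∀ g ∈ C, -e ≤ g → -k ≤ ∫ x, g x ∂μ) :
    ∃ ν : Measure X, IsFiniteMeasure ν ∧ ν.Regular ∧
      (∀ g ∈ C, ∫ x, g x ∂ν ≤ ∫ x, g x ∂μ) ∧ ∫ x, e x ∂ν ≤ k := by
  have hint : ∀ f : C(X, ℝ), Integrable f μ := fun f =>
    f.continuous.integrable_of_hasCompactSupport (HasCompactSupport.of_compactSpace f)
  -- The cone generated by the epigraph of `g ↦ ∫ g ∂μ` on `C` and the point `(e, k)`, closed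
  -- downwards in the first variable and upwards in the second.
  let s : PointedCone ℝ (C(X, ℝ) × ℝ) :=
    { carrier := {p | ∃ g ∈ C, ∃ t : ℝ, 0 ≤ t ∧ p.1 ≤ g + t • e ∧ ∫ x, g x ∂μ + t * k ≤ p.2}
      add_mem' := by
        rintro p q ⟨g, hg, t, ht, h1, h2⟩ ⟨g', hg', t', ht', h1', h2'⟩
        refine ⟨g + g', hadd g hg g' hg', t + t', add_nonneg ht ht', ?_, ?_⟩
        · calc p.1 + q.1 ≤ (g + t • e) + (g' + t' • e) := add_le_add h1 h1'
            _ = g + g' + (t + t') • e := by rw [add_smul]; abel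
        · have : ∫ x, (g + g') x ∂μ = ∫ x, g x ∂μ + ∫ x, g' x ∂μ :=
            integral_add (hint g) (hint g')
          rw [this, Prod.snd_add]
          linarith
      zero_mem' := by
        refine ⟨0, by simpa using hconst 0 le_rfl, 0, le_rfl, by simp, by simp⟩
      smul_mem' := by
        rintro ⟨c, hc⟩ p ⟨g, hg, t, ht, h1, h2⟩
        refine ⟨c • g, hsmul c hc g hg, c * t, mul_nonneg hc ht, ?_, ?_⟩
        · intro x
          have h3 : c * p.1 x ≤ c * (g x + t * e x) := mul_le_mul_of_nonneg_left (h1 x) hc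
          change c * p.1 x ≤ c * g x + c * t * e x
          linarith
        · have : ∫ x, (c • g) x ∂μ = c * ∫ x, g x ∂μ := integral_const_mul c _
          rw [this]
          change _ ≤ c * p.2
          nlinarith [mul_le_mul_of_nonneg_left h2 hc] }
  have h01 : ((0 : C(X, ℝ)), (1 : ℝ)) ≠ 0 := fun h => one_ne_zero (congrArg Prod.snd h)
  let f : (C(X, ℝ) × ℝ) →ₗ.[ℝ] ℝ := LinearPMap.mkSpanSingleton (0, 1) (1 : ℝ) h01
  have hdom : ∀ r : ℝ, ((0 : C(X, ℝ)), r) ∈ f.domain := fun r =>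
    Submodule.mem_span_singleton.mpr ⟨r, by simp⟩
  have hf : ∀ (r : ℝ) (h : ((0 : C(X, ℝ)), r) ∈ f.domain), f ⟨(0, r), h⟩ = r := by
    intro r h
    have h' : r • ((0 : C(X, ℝ)), (1 : ℝ)) ∈ f.domain := by simpa using h
    have := LinearPMap.mkSpanSingleton'_apply (σ := RingHom.id ℝ) ((0 : C(X, ℝ)), (1 : ℝ)) (1 : ℝ)
      (fun c hc => by simpa using congrArg Prod.snd hc) r h'
    simpa [f] using this
  have hpos : ∀ x : f.domain, (x : C(X, ℝ) × ℝ) ∈ s → 0 ≤ f x := by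
    rintro ⟨⟨p, r⟩, hp⟩ ⟨g, hg, t, ht, h1, h2⟩
    obtain ⟨c, hc⟩ := Submodule.mem_span_singleton.mp hp
    obtain rfl : 0 = p := by simpa using congrArg Prod.fst hc
    rw [hf]
    simp only at h1 h2
    refine le_trans ?_ h2
    rcases ht.eq_or_lt with rfl | ht
    · have : 0 ≤ ∫ x, g x ∂μ := integral_nonneg fun x => by simpa using h1 x
      simpa using this
    · have h3 := hk (t⁻¹ • g) (hsmul _ (inv_nonneg.mpr ht.le) g hg) fun x => by
        have h5 : 0 ≤ g x + t * e x := h1 x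
        change -e x ≤ t⁻¹ * g x
        rw [← mul_le_mul_iff_right₀ ht, mul_inv_cancel_left₀ ht.ne']
        linarith
      have h4 : ∫ x, (t⁻¹ • g) x ∂μ = t⁻¹ * ∫ x, g x ∂μ := integral_const_mul _ _
      rw [h4, ← mul_le_mul_iff_right₀ ht, mul_inv_cancel_left₀ ht.ne'] at h3
      linarith
  have hdense : ∀ y, ∃ x : f.domain, (x : C(X, ℝ) × ℝ) + y ∈ s := by
    rintro ⟨p, r⟩
    refine ⟨⟨(0, -r + ∫ x, ‖p‖ ∂μ), hdom _⟩, ContinuousMap.const X ‖p‖,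
      hconst _ (norm_nonneg _), 0, le_rfl, fun x => ?_, ?_⟩
    · simpa using (le_abs_self _).trans (p.norm_coe_le_norm x)
    · simp
  obtain ⟨L, hLf, hLs⟩ := riesz_extension s f hpos hdense
  have hL1 : ∀ r : ℝ, L (0, r) = r := fun r => (hLf ⟨_, hdom r⟩).trans (hf r (hdom r))
  have hLe : ∀ (p : C(X, ℝ)) (r : ℝ), (p, r) ∈ s → -L (p, 0) ≤ r := by
    intro p r h
    have h1 := hLs _ h
    have h2 : (p, r) = (p, (0 : ℝ)) + (0, r) := by simp
    rw [h2, map_add, hL1] at h1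
    linarith
  obtain ⟨ν, hν, hνr, hνL⟩ := exists_regular_measure_of_nonneg
    (-(L ∘ₗ LinearMap.inl ℝ C(X, ℝ) ℝ)) (fun p hp => by
      have : -L (-p, 0) ≤ 0 := hLe (-p) 0 ⟨0, by simpa using hconst 0 le_rfl, 0, le_rfl,
        by simpa using hp, by simp⟩
      have h2 : ((-p, 0) : C(X, ℝ) × ℝ) = -(p, 0) := by simp
      rw [h2, map_neg] at this
      simpa using this)
  refine ⟨ν, hν, hνr, fun g hg => ?_, ?_⟩
  · rw [hνL]
    exact hLe g _ ⟨g, hg, 0, le_rfl, by simp, by simp⟩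
  · rw [hνL]
    exact hLe e k ⟨0, by simpa using hconst 0 le_rfl, 1, zero_le_one, by simp, by simp⟩

/-! ### The function `1 / (1 + d)` -/

theorem continuous_projIcc_inv_one_add_dist :
    Continuous fun p : OffDiag M => projIcc (0 : ℝ) 1 zero_le_one (1 + dist p.1.1 p.1.2)⁻¹ := by
  refine continuous_projIcc.comp (Continuous.inv₀ (by fun_prop) fun p => ?_)
  positivity

/-- The continuous extension to `β M̃` of the function `1 / (1 + d)`. The extension to `β M̃` of the
metric, with values in `[0, ∞]`, is recovered from it as `1 / invOneAddDist - 1`. -/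
noncomputable def invOneAddDist (M : Type u) [MetricSpace M] : C(BetaOffDiag M, ℝ) where
  toFun ζ :=
    ((stoneCechExtend (continuous_projIcc_inv_one_add_dist (M := M)) ζ : Icc (0 : ℝ) 1) : ℝ)
  continuous_toFun := continuous_subtype_val.comp (continuous_stoneCechExtend _)

theorem invOneAddDist_apply (p : OffDiag M) :
    invOneAddDist M (stoneCechUnit p) = (1 + dist p.1.1 p.1.2)⁻¹ := by
  change
    ((stoneCechExtend (continuous_projIcc_inv_one_add_dist (M := M)) _ : Icc (0 : ℝ) 1) : ℝ) = _
  rw [stoneCechExtend_stoneCechUnit, projIcc_of_mem]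
  exact ⟨by positivity, inv_le_one_of_one_le₀ (by simp)⟩

theorem invOneAddDist_nonneg (ζ : BetaOffDiag M) : 0 ≤ invOneAddDist M ζ :=
  (stoneCechExtend (continuous_projIcc_inv_one_add_dist (M := M)) ζ).2.1

/-- The function `t ↦ t / (1 + t)` is monotone. -/
theorem div_one_add_le {s t : ℝ} (hs : 0 ≤ s) (hst : s ≤ t) : s / (1 + s) ≤ t / (1 + t) := by
  rw [div_le_div_iff₀ (by linarith) (by linarith)]
  nlinarith

/-- The function `t ↦ t / (1 + t)` is strictly subadditive on the positive reals. -/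
theorem div_one_add_add_lt {s t : ℝ} (hs : 0 < s) (ht : 0 < t) :
    (s + t) / (1 + (s + t)) < s / (1 + s) + t / (1 + t) := by
  rw [add_div]
  exact add_lt_add (div_lt_div_of_pos_left hs (by linarith) (by linarith))
    (div_lt_div_of_pos_left ht (by linarith) (by linarith))

theorem coord₁_apply (p : OffDiag M) : coord₁ (stoneCechUnit p) = toUComp p.1.1 :=
  stoneCechExtend_stoneCechUnit _ _

theorem coord₂_apply (p : OffDiag M) : coord₂ (stoneCechUnit p) = toUComp p.1.2 :=
  stoneCechExtend_stoneCechUnit _ _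

theorem continuous_coord₁ : Continuous (coord₁ : BetaOffDiag M → UComp M) :=
  continuous_stoneCechExtend _

theorem continuous_coord₂ : Continuous (coord₂ : BetaOffDiag M → UComp M) :=
  continuous_stoneCechExtend _

/-- The extended metric is finite where both coordinates are in the realcompactification. -/
theorem invOneAddDist_pos (o : M) {ζ : BetaOffDiag M} (h₁ : coord₁ ζ ∈ rcomp o)
    (h₂ : coord₂ ζ ∈ rcomp o) : 0 < invOneAddDist M ζ := by
  obtain ⟨hc, hd⟩ := ucompDist_spec o
  have key : ∀ η : BetaOffDiag M, (ENNReal.ofReal (invOneAddDist M η))⁻¹ ≤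
      1 + (ucompDist o (coord₁ η) + ucompDist o (coord₂ η)) := by
    have hcl : IsClosed {η : BetaOffDiag M | (ENNReal.ofReal (invOneAddDist M η))⁻¹ ≤
        1 + (ucompDist o (coord₁ η) + ucompDist o (coord₂ η))} := by
      refine isClosed_le ?_ ?_
      · exact (ENNReal.continuous_ofReal.comp (invOneAddDist M).continuous).inv
      · exact continuous_const.add ((hc.comp continuous_coord₁).add (hc.comp continuous_coord₂))
    intro η
    refine denseRange_stoneCechUnit.induction_on
      (p := fun η => (ENNReal.ofReal (invOneAddDist M η))⁻¹ ≤
        1 + (ucompDist o (coord₁ η) + ucompDist o (coord₂ η))) η hcl fun p => ?_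
    rw [invOneAddDist_apply, coord₁_apply, coord₂_apply, hd, hd,
      ← ENNReal.ofReal_inv_of_pos (by positivity), inv_inv,
      ENNReal.ofReal_add zero_le_one dist_nonneg, ENNReal.ofReal_one, ← edist_dist]
    gcongr
    exact edist_triangle_right _ _ _
  refine (invOneAddDist_nonneg ζ).lt_of_ne' fun h0 => ?_
  have := key ζ
  rw [h0, ENNReal.ofReal_zero, ENNReal.inv_zero, top_le_iff] at this
  exact (ENNReal.add_lt_top.mpr ⟨ENNReal.one_lt_top, ENNReal.add_lt_top.mpr ⟨h₁, h₂⟩⟩).ne this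

/-- The extended metric is positive where the two coordinates differ. -/
theorem invOneAddDist_lt_one {ζ : BetaOffDiag M} (h : coord₁ ζ ≠ coord₂ ζ) :
    invOneAddDist M ζ < 1 := by
  obtain ⟨f, hf⟩ : ∃ f : UnitUC M, (coord₁ ζ).val f ≠ (coord₂ ζ).val f := by
    by_contra! h'
    exact h (Subtype.ext (funext h'))
  have hδ : 0 < dist ((coord₁ ζ).val f) ((coord₂ ζ).val f) := dist_pos.mpr hf
  obtain ⟨η, hη, hfη⟩ := Metric.uniformContinuous_iff.mp f.2 _ (half_pos hδ)
  have key : ∀ ω : BetaOffDiag M,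
      dist ((coord₁ ω).val f) ((coord₂ ω).val f) ≤
        dist ((coord₁ ζ).val f) ((coord₂ ζ).val f) / 2 ∨ invOneAddDist M ω ≤ (1 + η)⁻¹ := by
    intro ω
    refine denseRange_stoneCechUnit.induction_on
      (p := fun ω => dist ((coord₁ ω).val f) ((coord₂ ω).val f) ≤
        dist ((coord₁ ζ).val f) ((coord₂ ζ).val f) / 2 ∨ invOneAddDist M ω ≤ (1 + η)⁻¹) ω
      ((isClosed_le (((UComp.continuous_apply f).comp continuous_coord₁).dist
        ((UComp.continuous_apply f).comp continuous_coord₂)) continuous_const).union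
        (isClosed_le (invOneAddDist M).continuous continuous_const)) fun p => ?_
    rw [invOneAddDist_apply, coord₁_apply, coord₂_apply]
    rcases lt_or_ge (dist p.1.1 p.1.2) η with hp | hp
    · exact Or.inl (hfη hp).le
    · right
      gcongr
  rcases key ζ with h1 | h1
  · linarith
  · exact h1.trans_lt (inv_lt_one_of_one_lt₀ (by linarith))

/-! ### The cone `G` -/

theorem add_mem_coneG {f g : C(BetaOffDiag M, ℝ)} (hf : f ∈ coneG M) (hg : g ∈ coneG M) :
    f + g ∈ coneG M := by
  intro x v y hxv hvy hxy
  have h1 := hf x v y hxv hvy hxy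
  have h2 := hg x v y hxv hvy hxy
  simp only [ContinuousMap.add_apply]
  linarith

theorem smul_mem_coneG {c : ℝ} (hc : 0 ≤ c) {g : C(BetaOffDiag M, ℝ)} (hg : g ∈ coneG M) :
    c • g ∈ coneG M := by
  intro x v y hxv hvy hxy
  have h1 := mul_le_mul_of_nonneg_left (hg x v y hxv hvy hxy) hc
  simp only [ContinuousMap.smul_apply, smul_eq_mul]
  linarith

theorem const_mem_coneG {c : ℝ} (hc : 0 ≤ c) :
    ContinuousMap.const (BetaOffDiag M) c ∈ coneG M := by
  intro x v y hxv hvy hxy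
  have h1 := mul_le_mul_of_nonneg_right (dist_triangle x v y) hc
  simp only [ContinuousMap.const_apply]
  linarith

theorem invOneAddDist_mem_coneG : invOneAddDist M ∈ coneG M := by
  intro x v y hxv hvy hxy
  simp only [invOneAddDist_apply, ← div_eq_mul_inv]
  exact (div_one_add_le dist_nonneg (dist_triangle x v y)).trans
    (div_one_add_add_lt (dist_pos.mpr hxv) (dist_pos.mpr hvy)).le

open Classical in
/-- The function `(x, y) ↦ d(x, y) g(x, y)` on `M × M`, with value `0` on the diagonal. -/
noncomputable def distMul (g : C(BetaOffDiag M, ℝ)) (x y : M) : ℝ :=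
  if h : x ≠ y then dist x y * g (stoneCechUnit ⟨(x, y), h⟩) else 0

theorem distMul_of_ne (g : C(BetaOffDiag M, ℝ)) (p : OffDiag M) :
    distMul g p.1.1 p.1.2 = dist p.1.1 p.1.2 * g (stoneCechUnit p) :=
  dif_pos p.2

theorem distMul_self (g : C(BetaOffDiag M, ℝ)) (x : M) : distMul g x x = 0 :=
  dif_neg (by simp)

theorem distMul_le (g : C(BetaOffDiag M, ℝ)) (x y : M) : distMul g x y ≤ dist x y * ‖g‖ := by
  by_cases h : x = y
  · subst h
    simp [distMul_self]
  · rw [distMul_of_ne g ⟨(x, y), h⟩]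
    exact mul_le_mul_of_nonneg_left ((le_abs_self _).trans (g.norm_coe_le_norm _)) dist_nonneg

/-- A member of `G` gives a triangle inequality for all triples of points. For triples `(x, v, x)`
it says that `d g` has nonnegative symmetrization, which needs a third point of `M`. -/
theorem distMul_triangle (hM : ∃ x y z : M, x ≠ y ∧ y ≠ z ∧ x ≠ z) {g : C(BetaOffDiag M, ℝ)}
    (hg : g ∈ coneG M) (x v y : M) : distMul g x y ≤ distMul g x v + distMul g v y := by
  have key : ∀ {x v y : M}, x ≠ v → v ≠ y → x ≠ y →
      distMul g x y ≤ distMul g x v + distMul g v y := by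
    intro x v y hxv hvy hxy
    rw [distMul_of_ne g ⟨(x, y), hxy⟩, distMul_of_ne g ⟨(x, v), hxv⟩,
      distMul_of_ne g ⟨(v, y), hvy⟩]
    exact hg x v y hxv hvy hxy
  by_cases hxv : x = v
  · subst hxv
    simp [distMul_self]
  by_cases hvy : v = y
  · subst hvy
    simp [distMul_self]
  by_cases hxy : x = y
  · subst hxy
    obtain ⟨w, hwx, hwv⟩ : ∃ w : M, w ≠ x ∧ w ≠ v := by
      by_contra! h
      obtain ⟨a, b, c, hab, hbc, hac⟩ := hM
      have := h a
      have := h b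
      have := h c
      by_cases a = x <;> by_cases b = x <;> by_cases c = x <;> simp_all
    have h1 := key hxv hwv.symm hwx.symm
    have h2 := key hvy hwx.symm hwv.symm
    rw [distMul_self]
    linarith
  · exact key hxv hvy hxy

/-! ### Pairs in `M̃` near two points of `β M̃` sharing a coordinate -/

/-- If the second coordinate of `ζ` equals the first coordinate of `ω`, then `ζ` and `ω` can be
approximated simultaneously by `(x, u)` and `(v, y)` with `d(u, v)` tending to `0`: otherwise a
uniformly continuous function would separate the two coordinates. -/
theorem neBot_nhds_of_coord_eq {ζ ω : BetaOffDiag M} (h : coord₂ ζ = coord₁ ω) :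
    (((comap stoneCechUnit (𝓝 ζ)) ×ˢ (comap stoneCechUnit (𝓝 ω))) ⊓
      comap (fun p : OffDiag M × OffDiag M => dist p.1.1.2 p.2.1.1) (𝓝 0)).NeBot := by
  rw [((((𝓝 ζ).basis_sets.comap stoneCechUnit).prod
    ((𝓝 ω).basis_sets.comap stoneCechUnit)).inf
      (Metric.nhds_basis_ball.comap _)).neBot_iff]
  rintro ⟨⟨U, V⟩, ε⟩ ⟨⟨hU, hV⟩, hε⟩
  simp only [id] at hU hV hε ⊢
  by_contra hne
  have hfar : ∀ p q : OffDiag M, stoneCechUnit p ∈ U → stoneCechUnit q ∈ V →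
      ε ≤ dist q.1.1 p.1.2 := by
    intro p q hp hq
    by_contra! hlt
    refine hne ⟨(p, q), ⟨hp, hq⟩, ?_⟩
    simpa [dist_comm] using hlt
  let B : Set M := {z | ∃ p : OffDiag M, stoneCechUnit p ∈ U ∧ p.1.2 = z}
  obtain ⟨p₀, hp₀⟩ := denseRange_stoneCechUnit.exists_mem_open isOpen_interior
    ⟨ζ, mem_interior_iff_mem_nhds.mpr hU⟩
  have hB : B.Nonempty := ⟨_, p₀, interior_subset hp₀, rfl⟩
  have hf : UniformContinuous fun z : M =>
      projIcc (0 : ℝ) 1 zero_le_one (ε⁻¹ * Metric.infDist z B) :=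
    (LipschitzWith.projIcc zero_le_one).uniformContinuous.comp
      ((uniformContinuous_const_smul ε⁻¹).comp (Metric.uniformContinuous_infDist_pt B))
  let F : UnitUC M := ⟨_, hf⟩
  have h0 : (coord₂ ζ).val F = 0 := by
    have hcl : IsClosed {η : BetaOffDiag M | (coord₂ η).val F = 0} :=
      isClosed_eq ((UComp.continuous_apply F).comp continuous_coord₂) continuous_const
    refine (hcl.closure_subset_iff (s := stoneCechUnit '' (stoneCechUnit ⁻¹' U))).mpr ?_ ?_
    · rintro _ ⟨p, hp, rfl⟩
      change (coord₂ _).val F = 0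
      rw [coord₂_apply]
      change projIcc (0 : ℝ) 1 zero_le_one (ε⁻¹ * Metric.infDist p.1.2 B) = 0
      rw [Metric.infDist_zero_of_mem (s := B) ⟨p, hp, rfl⟩, mul_zero]
      exact projIcc_left (zero_le_one (α := ℝ))
    · rw [image_preimage_eq_inter_range]
      exact mem_closure_iff_nhds.mpr fun W hW => by
        obtain ⟨p, hp⟩ := denseRange_stoneCechUnit.exists_mem_open isOpen_interior
          ⟨ζ, mem_interior_iff_mem_nhds.mpr (inter_mem hU hW)⟩
        exact ⟨_, (interior_subset hp).2, (interior_subset hp).1, p, rfl⟩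
  have h1 : (coord₁ ω).val F = 1 := by
    have hcl : IsClosed {η : BetaOffDiag M | (coord₁ η).val F = 1} :=
      isClosed_eq ((UComp.continuous_apply F).comp continuous_coord₁) continuous_const
    refine (hcl.closure_subset_iff (s := stoneCechUnit '' (stoneCechUnit ⁻¹' V))).mpr ?_ ?_
    · rintro _ ⟨q, hq, rfl⟩
      change (coord₁ _).val F = 1
      rw [coord₁_apply]
      change projIcc (0 : ℝ) 1 zero_le_one (ε⁻¹ * Metric.infDist q.1.1 B) = 1
      refine projIcc_of_right_le _ ?_
      have : ε ≤ Metric.infDist q.1.1 B := (Metric.le_infDist hB).mpr fun {z} hz => by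
        obtain ⟨p, hp, rfl⟩ := hz
        exact hfar p q hp hq
      rw [← inv_mul_cancel₀ (show ε ≠ 0 from ne_of_gt hε)]
      exact mul_le_mul_of_nonneg_left this (inv_nonneg.mpr (le_of_lt hε))
    · rw [image_preimage_eq_inter_range]
      exact mem_closure_iff_nhds.mpr fun W hW => by
        obtain ⟨p, hp⟩ := denseRange_stoneCechUnit.exists_mem_open isOpen_interior
          ⟨ω, mem_interior_iff_mem_nhds.mpr (inter_mem hV hW)⟩
        exact ⟨_, (interior_subset hp).2, (interior_subset hp).1, p, rfl⟩
  rw [h, h1] at h0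
  exact one_ne_zero h0

/-- The inequality `d(x, y) g(x, y) ≤ d(x, u) g(x, u) + d(u, y) g(u, y)` extended to points
`ζ = (x, u)` and `ω = (u, y)` of `β M̃` that share a coordinate. As there is no canonical point
`(x, y)` of `β M̃`, the left side is replaced by its lower bound
`-d(x, y) / (1 + d(x, y)) ≥ -(a + b) / (1 + (a + b))`, where `a` and `b` are the extended
distances at `ζ` and `ω`. -/
theorem le_of_coord_eq (hM : ∃ x y z : M, x ≠ y ∧ y ≠ z ∧ x ≠ z) {g : C(BetaOffDiag M, ℝ)}
    (hg : g ∈ coneG M) (hge : -invOneAddDist M ≤ g) {ζ ω : BetaOffDiag M}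
    (h : coord₂ ζ = coord₁ ω) {a b : ℝ} (ha : 0 ≤ a) (hb : 0 ≤ b)
    (hζ : invOneAddDist M ζ = (1 + a)⁻¹) (hω : invOneAddDist M ω = (1 + b)⁻¹) :
    -((a + b) / (1 + (a + b))) ≤ a * g ζ + b * g ω := by
  have hne := neBot_nhds_of_coord_eq h
  set F := ((comap stoneCechUnit (𝓝 ζ)) ×ˢ (comap stoneCechUnit (𝓝 ω))) ⊓
      comap (fun p : OffDiag M × OffDiag M => dist p.1.1.2 p.2.1.1) (𝓝 0) with hF
  have t1 : Tendsto (fun p : OffDiag M × OffDiag M => stoneCechUnit p.1) F (𝓝 ζ) :=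
    (tendsto_comap (f := stoneCechUnit)).comp (tendsto_fst.mono_left inf_le_left)
  have t2 : Tendsto (fun p : OffDiag M × OffDiag M => stoneCechUnit p.2) F (𝓝 ω) :=
    (tendsto_comap (f := stoneCechUnit)).comp (tendsto_snd.mono_left inf_le_left)
  have t3 : Tendsto (fun p : OffDiag M × OffDiag M => dist p.1.1.2 p.2.1.1) F (𝓝 0) :=
    tendsto_comap.mono_left inf_le_right
  have hdist : ∀ {f : OffDiag M × OffDiag M → OffDiag M} {η : BetaOffDiag M} {c : ℝ}, 0 ≤ c →
      invOneAddDist M η = (1 + c)⁻¹ → Tendsto (fun p => stoneCechUnit (f p)) F (𝓝 η) →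
      Tendsto (fun p => dist (f p).1.1 (f p).1.2) F (𝓝 c) := by
    intro f η c hc hη ht
    have h1 := ((invOneAddDist M).continuous.tendsto η).comp ht
    rw [hη] at h1
    have h2 := (h1.inv₀ (by positivity)).sub_const 1
    simpa [Function.comp_def, invOneAddDist_apply] using h2
  have ta := hdist ha hζ t1
  have tb := hdist hb hω t2
  have tg1 := ta.mul ((g.continuous.tendsto ζ).comp t1)
  have tg2 := tb.mul ((g.continuous.tendsto ω).comp t2)
  have hR := (tg1.add (t3.mul_const ‖g‖)).add tg2
  have hS := (ta.add t3).add tb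
  have hL := (hS.div (hS.const_add 1) (by rw [add_zero]; positivity)).neg
  simp only [zero_mul, add_zero] at hR hL
  refine le_of_tendsto_of_tendsto' hL hR fun ⟨p, q⟩ => ?_
  have e1 := distMul_triangle hM hg p.1.1 q.1.1 q.1.2
  have e2 := distMul_triangle hM hg p.1.1 p.1.2 q.1.1
  have e3 := distMul_le g p.1.2 q.1.1
  rw [distMul_of_ne g q] at e1
  rw [distMul_of_ne g p] at e2
  have e4 : -(dist p.1.1 q.1.2 / (1 + dist p.1.1 q.1.2)) ≤ distMul g p.1.1 q.1.2 := by
    by_cases hpq : p.1.1 = q.1.2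
    · simp [hpq, distMul_self]
    · rw [distMul_of_ne g ⟨(p.1.1, q.1.2), hpq⟩]
      have h1 : -invOneAddDist M (stoneCechUnit ⟨(p.1.1, q.1.2), hpq⟩) ≤ _ := hge _
      rw [invOneAddDist_apply] at h1
      rw [div_eq_mul_inv, ← mul_neg]
      exact mul_le_mul_of_nonneg_left h1 dist_nonneg
  have e5 := div_one_add_le dist_nonneg (dist_triangle4 p.1.1 p.1.2 q.1.1 q.1.2)
  simp only [Function.comp_apply, Pi.div_apply]
  linarith

/-! ### Minimal measures -/

theorem integrable_continuousMap (μ : Measure (BetaOffDiag M)) [IsFiniteMeasure μ]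
    (f : C(BetaOffDiag M, ℝ)) : Integrable f μ :=
  f.continuous.integrable_of_hasCompactSupport (HasCompactSupport.of_compactSpace f)

/-- For a minimal measure `μ`, the function `-1 / (1 + d)` can be approximated from above in
`L¹(μ)` by members of the cone `G`. -/
theorem IsMinimal.exists_integral_lt {μ : Measure (BetaOffDiag M)} (hμ : IsMinimal μ) {ε : ℝ}
    (hε : 0 < ε) : ∃ g ∈ coneG M, -invOneAddDist M ≤ g ∧
      ∫ ζ, (g ζ + invOneAddDist M ζ) ∂μ < ε := by
  have := hμ.1.1
  by_contra! hcon
  obtain ⟨ν, hν, hνr, hle, hk⟩ := exists_measure_le_on_cone μ (coneG M)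
    (fun f hf g hg => add_mem_coneG hf hg) (fun c hc g hg => smul_mem_coneG hc hg)
    (fun c hc => const_mem_coneG hc) (invOneAddDist M) (∫ ζ, invOneAddDist M ζ ∂μ - ε)
    (fun g hg hge => by
      have h1 := hcon g hg hge
      rw [integral_add (integrable_continuousMap μ g) (integrable_continuousMap μ _)] at h1
      linarith)
  have h2 := hμ.2 ν ⟨hν, hνr⟩ hle _ invOneAddDist_mem_coneG
  linarith

/-- For a minimal measure `μ`, some sequence of members of `G` above `-1 / (1 + d)`
converges to it `μ`-almost everywhere. -/
theorem IsMinimal.exists_seq_tendsto {μ : Measure (BetaOffDiag M)} (hμ : IsMinimal μ) :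
    ∃ g : ℕ → C(BetaOffDiag M, ℝ), (∀ n, g n ∈ coneG M ∧ -invOneAddDist M ≤ g n) ∧
      ∀ᵐ ζ ∂μ, Tendsto (fun n => g n ζ) atTop (𝓝 (-invOneAddDist M ζ)) := by
  have := hμ.1.1
  choose g hg hge hlt using fun n : ℕ =>
    hμ.exists_integral_lt (Nat.one_div_pos_of_nat (α := ℝ) (n := n))
  have hmeas : TendstoInMeasure μ (fun n => g n) atTop (-invOneAddDist M : C(_, ℝ)) := by
    refine tendstoInMeasure_of_tendsto_eLpNorm one_ne_zero
      (fun n => (integrable_continuousMap μ _).aestronglyMeasurable)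
      (integrable_continuousMap μ _).aestronglyMeasurable ?_
    have hle : ∀ n, eLpNorm (⇑(g n) - ⇑(-invOneAddDist M)) 1 μ ≤
        ENNReal.ofReal (1 / ((n : ℝ) + 1)) := by
      intro n
      have hnn : ∀ ζ, 0 ≤ g n ζ + invOneAddDist M ζ := fun ζ => by
        have : -invOneAddDist M ζ ≤ g n ζ := hge n ζ
        linarith
      rw [eLpNorm_one_eq_lintegral_enorm]
      refine le_trans (le_of_eq ?_) (ENNReal.ofReal_le_ofReal (hlt n).le)
      rw [ofReal_integral_eq_lintegral_ofReal (f := fun ζ => g n ζ + invOneAddDist M ζ)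
        ((integrable_continuousMap μ _).add (integrable_continuousMap μ _))
        (Eventually.of_forall hnn)]
      refine lintegral_congr fun ζ => ?_
      rw [← Real.enorm_of_nonneg (hnn ζ)]
      simp
    refine tendsto_of_tendsto_of_tendsto_of_le_of_le tendsto_const_nhds ?_
      (fun n => zero_le) hle
    simpa using ENNReal.tendsto_ofReal tendsto_one_div_add_atTop_nhds_zero_nat
  obtain ⟨ns, -, hns⟩ := hmeas.exists_seq_tendsto_ae
  exact ⟨fun n => g (ns n), fun n => ⟨hg _, hge _⟩, hns⟩

/-- If members of `G` above `-1 / (1 + d)` converge to it at two points of `β M̃` where the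
extended metric is positive and finite, then these points cannot be concatenated: otherwise
`a / (1 + a) + b / (1 + b) ≤ (a + b) / (1 + (a + b))` for their distances `a` and `b`. -/
theorem coord_ne_of_tendsto (hM : ∃ x y z : M, x ≠ y ∧ y ≠ z ∧ x ≠ z) (o : M)
    {g : ℕ → C(BetaOffDiag M, ℝ)} (hg : ∀ n, g n ∈ coneG M ∧ -invOneAddDist M ≤ g n)
    {ζ ω : BetaOffDiag M} (hζ : ζ ∈ distinctRealCoords o) (hω : ω ∈ distinctRealCoords o)
    (tζ : Tendsto (fun n => g n ζ) atTop (𝓝 (-invOneAddDist M ζ)))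
    (tω : Tendsto (fun n => g n ω) atTop (𝓝 (-invOneAddDist M ω))) :
    coord₂ ζ ≠ coord₁ ω := by
  intro h
  have hex : ∀ η ∈ distinctRealCoords o, ∃ a : ℝ, 0 < a ∧ invOneAddDist M η = (1 + a)⁻¹ := by
    rintro η ⟨h1, h2, h3⟩
    have := invOneAddDist_pos o h1 h2
    refine ⟨(invOneAddDist M η)⁻¹ - 1, ?_, by simp⟩
    linarith [(one_lt_inv₀ this).mpr (invOneAddDist_lt_one h3)]
  obtain ⟨a, ha, hζa⟩ := hex ζ hζ
  obtain ⟨b, hb, hωb⟩ := hex ω hω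
  have hlim := ge_of_tendsto' ((tζ.const_mul a).add (tω.const_mul b)) fun n =>
    le_of_coord_eq hM (hg n).1 (hg n).2 h ha.le hb.le hζa hωb
  have hlt := div_one_add_add_lt ha hb
  rw [hζa, hωb] at hlim
  simp only [div_eq_mul_inv] at hlt hlim
  linarith

/-- A regular finite measure concentrated on a set whose images under two continuous maps are
disjoint has mutually singular push-forwards under these maps. Inner regularity replaces the set by
a `σ`-compact one, whose images are Borel. -/
theorem mutuallySingular_map_of_forall_ne {X Y : Type*} [TopologicalSpace X] [T2Space X]
    [MeasurableSpace X] [BorelSpace X] [TopologicalSpace Y] [T2Space Y] [MeasurableSpace Y]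
    [BorelSpace Y] {μ : Measure X} [IsFiniteMeasure μ] [μ.Regular] {p q : X → Y}
    (hp : Continuous p) (hq : Continuous q) {S : Set X} (hS : μ Sᶜ = 0)
    (h : ∀ x ∈ S, ∀ y ∈ S, q x ≠ p y) : (μ.map p).MutuallySingular (μ.map q) := by
  set T : Set X := (toMeasurable μ Sᶜ)ᶜ with hT
  have hTS : T ⊆ S := compl_subset_comm.mp (subset_toMeasurable μ Sᶜ)
  have hT0 : μ Tᶜ = 0 := by rw [hT, compl_compl, measure_toMeasurable, hS]
  have hex : ∀ n : ℕ, ∃ K ⊆ T, IsCompact K ∧ μ (T \ K) < ((n : ℝ≥0∞) + 1)⁻¹ := fun n =>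
    (measurableSet_toMeasurable μ Sᶜ).compl.exists_isCompact_sdiff_lt
      (measure_ne_top μ _) (by simp)
  choose K hKT hK hlt using hex
  have hnull : μ (⋃ n, K n)ᶜ = 0 := by
    have h1 : μ (T \ ⋃ n, K n) = 0 := by
      refine le_antisymm (ge_of_tendsto' (x := atTop)
        (f := fun n : ℕ => ((n : ℝ≥0∞) + 1)⁻¹) ?_ fun n => ?_) zero_le
      · have := ENNReal.tendsto_inv_nat_nhds_zero.comp (tendsto_add_atTop_nat 1)
        simpa [Function.comp_def] using this
      · exact (measure_mono (sdiff_subset_sdiff_right (subset_iUnion K n))).trans (hlt n).le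
    refine measure_mono_null (fun x hx => ?_) (measure_union_null hT0 h1)
    by_cases hxT : x ∈ T
    · exact Or.inr ⟨hxT, hx⟩
    · exact Or.inl hxT
  have himg : ∀ {r : X → Y}, Continuous r → μ.map r (⋃ n, r '' K n)ᶜ = 0 := by
    intro r hr
    rw [Measure.map_apply hr.measurable
      (MeasurableSet.iUnion fun n => ((hK n).image hr).measurableSet).compl]
    refine measure_mono_null (t := (⋃ n, K n)ᶜ) (fun x hx hxK => hx ?_) hnull
    obtain ⟨n, hn⟩ := mem_iUnion.mp hxK
    exact mem_iUnion.mpr ⟨n, x, hn, rfl⟩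
  refine Measure.MutuallySingular.mk (himg hp) (himg hq) fun y _ => ?_
  by_contra hy
  simp only [mem_union, mem_compl_iff, not_or, not_not, mem_iUnion] at hy
  obtain ⟨⟨m, x, hx, rfl⟩, n, z, hz, hzx⟩ := hy
  exact h z (hTS (hKT n hz)) x (hTS (hKT m hx)) hzx

end LipFree

/-- `M` is a complete metric space with base point `o` and at least three points; a minimal
measure that is concentrated on the points of `β M̃` with distinct coordinates in the Lipschitz
realcompactification has mutually singular marginals. -/
theorem theorem3p7 {M : Type*} [MetricSpace M] [CompleteSpace M] (o : M)
    (hM : ∃ x y z : M, x ≠ y ∧ y ≠ z ∧ x ≠ z)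
    (μ : MeasureTheory.Measure (LipFree.BetaOffDiag M))
    (hmin : LipFree.IsMinimal μ)
    (hconc : μ (LipFree.distinctRealCoords o)ᶜ = 0) :
    (MeasureTheory.Measure.map LipFree.coord₁ μ).MutuallySingular
      (MeasureTheory.Measure.map LipFree.coord₂ μ) := by
  have := hmin.1.1
  have := hmin.1.2
  obtain ⟨g, hg, hlim⟩ := hmin.exists_seq_tendsto
  have hae : ∀ᵐ ζ ∂μ, ζ ∈ LipFree.distinctRealCoords o ∧
      Tendsto (fun n => g n ζ) atTop (𝓝 (-LipFree.invOneAddDist M ζ)) :=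
    (show ∀ᵐ ζ ∂μ, ζ ∈ LipFree.distinctRealCoords o from hconc).and hlim
  exact LipFree.mutuallySingular_map_of_forall_ne LipFree.continuous_coord₁
    LipFree.continuous_coord₂ hae fun ζ hζ ω hω =>
      LipFree.coord_ne_of_tendsto hM o hg hζ.1 hω.1 hζ.2 hω.2
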